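/- Let $\kappa$ be a regular uncountable cardinal, let $\theta<\lambda<\kappa$ be infinite cardinals, let $S$ be a stationary subset of $E^\kappa_\lambda:=\{\delta<\kappa\mid \mathrm{cf}(\delta)=\lambda\}$, and let $T\subseteq\kappa$. Conventions. For an ordinal $\delta$, $J^{\mathrm{bd}}[\delta]:=\{B\subseteq\delta\mid \sup(B)<\delta\}$. For a set of ordinals $A$, $\mathrm{otp}(A)$ is its order type and $\mathrm{acc}(A):=\{\alpha\in A\mid \sup(A\cap\alpha)=\alpha>0\}$; $\mathrm{suc}_1(A)$ is the set whose only member is the second element of $A$ (it is empty if $A$ has fewer than two elements). A $C$-sequence over $R\subseteq\kappa$ is a sequence $\langle C_\delta\mid\delta\in R\rangle$ such that each $C_\delta$ is a closed subset of $\delta$ with $\sup(C_\delta)=\sup(\delta)$; it is $\lambda$-bounded if $\mathrm{otp}(C_\delta)\le\lambda$ for all $\delta\in R$. A $C$-sequence $\langle C_\delta\mid\delta<\kappa\rangle$ is weakly coherent if $|\{C_\delta\cap\alpha\mid\delta<\kappa\}|<\kappa$ for every $\alpha<\kappa$, and, for an infinite cardinal $\chi$, it is $\sqsubseteq_\chi$-coherent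 if $C_{\bar\delta}=C_\delta\cap\bar\delta$ for all $\delta<\kappa$ and all $\bar\delta\in\mathrm{acc}(C_\delta)$ with $\mathrm{cf}(\bar\delta)\ge\chi$. Suppose that there is a colouring $c:[\lambda]^2\to\theta$ with $c(\alpha,\beta)<\beta$ for all $\alpha<\beta<\lambda$, such that for every $B\subseteq\lambda$ unbounded in $\lambda$ there is $\eta<\lambda$ with $\mathrm{otp}(\{c(\eta,\beta)\mid \beta\in B,\ \eta<\beta\})=\theta$ (that is, $\mathrm{ubd}(J^{\mathrm{bd}}[\lambda],\theta)$ holds). Let $\vec C=\langle C_\delta\mid\delta<\kappa\rangle$ be a $C$-sequence such that $\vec C\restriction S$ witnesses $\mathrm{CG}_\lambda(S,T)$: it is $\lambda$-bounded and for every club $D\subseteq\kappa$ there is $\delta\in S$ such that $$\sup\{\beta<\delta\mid \mathrm{suc}_1(C_\delta\setminus\beta)\subseteq D\cap T\}=\delta .$$ Then there is a $C$-sequence $\vec{C^\bullet}=\langle C^\bullet_\delta\mid\delta<\kappa\rangle$ such that: \begin{itemize} \item $\vec{C^\bullet}\restriction S$ is $\lambda$-bounded; \item if $\vec C$ is weakly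 coherent, then so is $\vec{C^\bullet}$; \item for every infinite cardinal $\chi$ with $\theta\le\chi<\kappa$, if $\vec C$ is $\sqsubseteq_\chi$-coherent, then so is $\vec{C^\bullet}$; \item $\theta\in\Theta_1(\vec{C^\bullet}\restriction S,T)$, that is, there is a function $h:\kappa\to\theta$ such that for every club $D\subseteq\kappa$ there is $\delta\in S$ such that for every $\tau<\theta$, $$\sup\{\beta<\delta\mid h(\mathrm{otp}(C^\bullet_\delta\cap\beta))=\tau\ \text{and}\ \mathrm{suc}_1(C^\bullet_\delta\setminus\beta)\subseteq D\cap T\}=\delta .$$ \end{itemize} -/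

import Mathlib

open Cardinal Ordinal Set

universe u

noncomputable section

namespace ClubGuessing

/-- The order type `otp(A)` of a (bounded) set of ordinals: the ordinal `o` such that `A` is
order-isomorphic to the set `{α | α < o}`. -/
def otp (A : Set Ordinal.{u}) : Ordinal.{u} :=
  sInf {o : Ordinal.{u} | Nonempty (A ≃o Iio o)}

/-- Every bounded set of ordinals really is isomorphic to its order type. -/
theorem nonempty_orderIso_otp {A : Set Ordinal.{u}} (hA : BddAbove A) :
    Nonempty (A ≃o Iio (otp A)) := by
  suffices h : {o : Ordinal.{u} | Nonempty (A ≃o Iio o)}.Nonempty from csInf_mem h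
  obtain ⟨b, hb⟩ := hA
  have hle : typeLT A ≤ Ordinal.lift.{u + 1} (Order.succ b) := by
    rw [← type_lt_Iio]
    exact type_le_iff'.2 ⟨(Subrel.inclusionEmbedding (· < ·)
      (fun a ha => Order.lt_succ_of_le (hb ha) : A ⊆ Iio (Order.succ b)))⟩
  obtain ⟨o, ho⟩ := mem_range_lift_of_le hle
  rw [← type_lt_Iio, type_eq] at ho
  obtain ⟨e⟩ := ho
  exact ⟨o, ⟨(OrderIso.ofRelIsoLT e).symm⟩⟩

/-- The set `acc(A)` of accumulation points of `A` that belong to `A`. -/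
def acc (A : Set Ordinal.{u}) : Set Ordinal.{u} :=
  {α ∈ A | sSup (A ∩ Iio α) = α ∧ 0 < α}

/-- `D` is a closed and unbounded subset of the ordinal `δ`. -/
def IsClubIn (δ : Ordinal.{u}) (D : Set Ordinal.{u}) : Prop :=
  D ⊆ Iio δ ∧ IsClub (Subtype.val ⁻¹' D : Set (Iio δ))

/-- `S` is a stationary subset of the ordinal `δ`. -/
def IsStationaryIn (δ : Ordinal.{u}) (S : Set Ordinal.{u}) : Prop :=
  S ⊆ Iio δ ∧ IsStationary (Subtype.val ⁻¹' S : Set (Iio δ))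

/-- The set `E^κ_μ` of ordinals below `κ` of cofinality `μ`. -/
def cofEq (κ μ : Cardinal.{u}) : Set Ordinal.{u} :=
  {α | α < κ.ord ∧ α.cof = μ}

/-- The set `E^κ_{≥χ}` of ordinals below `κ` of cofinality at least `χ`. -/
def cofGe (κ χ : Cardinal.{u}) : Set Ordinal.{u} :=
  {α | α < κ.ord ∧ χ ≤ α.cof}

/-- `⟨C δ | δ ∈ S⟩` is a `C`-sequence over `S`: each `C δ` is a closed subset of `δ` with
`sup (C δ) = sup δ`.  Only the values `C δ` for `δ ∈ S` matter. -/
def IsCSeq (S : Set Ordinal.{u}) (C : Ordinal.{u} → Set Ordinal.{u}) : Prop :=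
  ∀ δ ∈ S, C δ ⊆ Iio δ ∧
    (∀ α < δ, 0 < α → sSup (C δ ∩ Iio α) = α → α ∈ C δ) ∧
    sSup (C δ) = sSup (Iio δ)

/-- `⟨C δ | δ ∈ S⟩` is `ξ`-bounded. -/
def IsBoundedSeq (ξ : Ordinal.{u}) (S : Set Ordinal.{u})
    (C : Ordinal.{u} → Set Ordinal.{u}) : Prop :=
  ∀ δ ∈ S, otp (C δ) ≤ ξ

/-- `suc_σ(C) = {C(j+1) | j < σ, j + 1 < otp(C)}`, where `C(i)` is the `i`-th element of `C`,
that is, the `γ ∈ C` with `otp(C ∩ γ) = i`. -/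
def suc (σ : Ordinal.{u}) (C : Set Ordinal.{u}) : Set Ordinal.{u} :=
  {γ ∈ C | ∃ j < σ, otp (C ∩ Iio γ) = j + 1}

/-- The ideal `J^bd[δ]` of bounded subsets of `δ`. -/
def Jbd (δ : Ordinal.{u}) : Set (Set Ordinal.{u}) :=
  {B | B ⊆ Iio δ ∧ sSup B < δ}

/-- The collection `J⁺` of subsets of `δ` that do not belong to the ideal `J` over `δ`. -/
def positive (δ : Ordinal.{u}) (J : Set (Set Ordinal.{u})) : Set (Set Ordinal.{u}) :=
  {B | B ⊆ Iio δ ∧ B ∉ J}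

/-- `⟨C δ | δ ∈ S⟩` witnesses `CG_ξ(S, T, σ, ⟨J δ | δ ∈ S⟩)`. -/
def WitnessesCG (κ : Cardinal.{u}) (ξ : Ordinal.{u}) (S T : Set Ordinal.{u}) (σ : Ordinal.{u})
    (J : Ordinal.{u} → Set (Set Ordinal.{u})) (C : Ordinal.{u} → Set Ordinal.{u}) : Prop :=
  IsCSeq S C ∧ IsBoundedSeq ξ S C ∧
    ∀ D, IsClubIn κ.ord D → ∃ δ ∈ S,
      {β | β < δ ∧ suc σ (C δ \ Iio β) ⊆ D ∩ T} ∈ positive δ (J δ)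

/-- The set of cardinals `Θ₁(⟨C δ | δ ∈ S⟩, T, σ, ⟨J δ | δ ∈ S⟩)`. -/
def Theta1 (κ : Cardinal.{u}) (S : Set Ordinal.{u}) (C : Ordinal.{u} → Set Ordinal.{u})
    (T : Set Ordinal.{u}) (σ : Ordinal.{u}) (J : Ordinal.{u} → Set (Set Ordinal.{u})) :
    Set Cardinal.{u} :=
  {θ | ∃ h : Ordinal.{u} → Ordinal.{u}, MapsTo h (Iio κ.ord) (Iio θ.ord) ∧
    ∀ D, IsClubIn κ.ord D → ∃ δ ∈ S, ∀ τ < θ.ord,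
      {β | β < δ ∧ h (otp (C δ ∩ Iio β)) = τ ∧ suc σ (C δ \ Iio β) ⊆ D ∩ T} ∈
        positive δ (J δ)}

/-- `⟨C δ | δ < κ⟩` is weakly coherent. -/
def IsWeaklyCoherent (κ : Cardinal.{u}) (C : Ordinal.{u} → Set Ordinal.{u}) : Prop :=
  ∀ α < κ.ord, #((fun δ => C δ ∩ Iio α) '' Iio κ.ord) < Cardinal.lift.{u + 1} κ

/-- `⟨C δ | δ < κ⟩` is `⊑_χ`-coherent. -/
def IsCoherent (κ χ : Cardinal.{u}) (C : Ordinal.{u} → Set Ordinal.{u}) : Prop :=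
  ∀ δ < κ.ord, ∀ δ' ∈ acc (C δ) ∩ cofGe κ χ, C δ' = C δ ∩ Iio δ'

/-- The principle `unbounded(J, θ)` for an ideal `J` over the cardinal `lam`: there is an
upper-regressive colouring `c : [lam]² → θ` such that for every `B ∈ J⁺` there is `η < lam` for
which the set of colours `c(η, β)`, `β ∈ B`, `η < β`, has order type `θ`. -/
def Ubd (lam : Cardinal.{u}) (J : Set (Set Ordinal.{u})) (θ : Cardinal.{u}) : Prop :=
  ∃ c : Ordinal.{u} → Ordinal.{u} → Ordinal.{u},
    (∀ α β, α < β → β < lam.ord → c α β < θ.ord ∧ c α β < β) ∧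
    ∀ B ∈ positive lam.ord J, ∃ η < lam.ord, otp (c η '' {β ∈ B | η < β}) = θ.ord

end ClubGuessing

end

noncomputable section

namespace ClubGuessing

/-! Each `C δ` is thickened by inserting, after every γ ∈ `C δ`, an interval of length less than θ.
Fix `h` taking every value below θ on every interval of length θ; the inserted length is chosen so
that the position of the interval's last point has a prescribed `h`-colour K(C_δ ∩ γ). If the
successor ν of γ in `C δ` is at least γ + θ, then ν comes right after that last point
(`fill_add_gap_spec`), so a guess at γ becomes a guess at a position of colour K(C_δ ∩ γ). The gap
is guaranteed by guessing inside the club of ordinals closed under adding θ. Since K reads only C_δ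
∩ γ, thickening commutes with truncation (`fill_inter_Iio`) and coherence survives; the only new
accumulation points have cofinality below θ.

It remains to find K such that for every club D some δ ∈ S has each τ < θ equal to K(C_δ ∩ β) for
cofinally many β with successor in D ∩ T. The raw colour of β is c(η, otp(C_δ ∩ β)). A sparseness
argument (`exists_many_unbounded_colours`) improves the hypothesis on c to θ many colours attained
cofinally, and `exists_forall_isClubIn` makes η independent of D. These colours form a subset A of θ
of order type θ, but A depends on δ, so it cannot be read off directly. `exists_isClubIn_stable`
gives a club E below which A no longer shrinks, and past a uniform position ε only colours in A
occur at guesses into E ∩ T. Hence for β high enough, the colours seen in C_δ ∩ β past ε are exactly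
those in A, and if β has raw colour τ₀ ∈ A, the order type of the seen colours below τ₀ is the index
of τ₀ in A. This local quantity is K, and every index τ < θ is realised cofinally
(`exists_collapsedColour_eq`). -/

/-! ### Order types of sets of ordinals -/

theorem eq_of_orderIso_Iio {o o' : Ordinal.{u}} (e : Iio o ≃o Iio o') : o = o' := by
  have h : typeLT (Iio o) = typeLT (Iio o') := type_eq.2 ⟨e.toRelIsoLT⟩
  rwa [type_lt_Iio, type_lt_Iio, Ordinal.lift_inj] at h

theorem otp_eq_of_strictMonoOn {A : Set Ordinal.{u}} {f : Ordinal.{u} → Ordinal.{u}}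
    {o : Ordinal.{u}} (hf : StrictMonoOn f A) (him : f '' A = Iio o) : otp A = o := by
  have e : Nonempty (A ≃o Iio o) := ⟨him ▸ hf.orderIso f A⟩
  have hmem : otp A ∈ {o : Ordinal.{u} | Nonempty (A ≃o Iio o)} := csInf_mem ⟨o, e⟩
  obtain ⟨e⟩ := e
  obtain ⟨e'⟩ := hmem
  exact eq_of_orderIso_Iio (e'.symm.trans e)

theorem exists_strictMonoOn_otp {A : Set Ordinal.{u}} (hA : BddAbove A) :
    ∃ f : Ordinal.{u} → Ordinal.{u}, StrictMonoOn f A ∧ f '' A = Iio (otp A) := by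
  classical
  obtain ⟨e⟩ := nonempty_orderIso_otp hA
  refine ⟨fun x => if h : x ∈ A then (e ⟨x, h⟩ : Ordinal) else 0, ?_, ?_⟩
  · intro x hx y hy hxy
    simp only [hx, hy, dif_pos]
    exact e.strictMono (show (⟨x, hx⟩ : A) < ⟨y, hy⟩ from hxy)
  · ext y
    constructor
    · rintro ⟨x, hx, rfl⟩
      simp only [hx, dif_pos]
      exact (e ⟨x, hx⟩).2
    · intro hy
      refine ⟨e.symm ⟨y, hy⟩, (e.symm ⟨y, hy⟩).2, ?_⟩
      simp

theorem mk_eq_lift_card_otp {A : Set Ordinal.{u}} (hA : BddAbove A) :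
    #A = Cardinal.lift.{u + 1} (otp A).card := by
  obtain ⟨e⟩ := nonempty_orderIso_otp hA
  rw [← Cardinal.mk_Iio_ordinal]
  exact Cardinal.mk_congr e.toEquiv

theorem bddAbove_of_subset_Iio {A : Set Ordinal.{u}} {δ : Ordinal.{u}} (h : A ⊆ Iio δ) :
    BddAbove A := ⟨δ, fun _ hx => (h hx).le⟩

theorem bddAbove_inter_Iio (A : Set Ordinal.{u}) (δ : Ordinal.{u}) : BddAbove (A ∩ Iio δ) :=
  bddAbove_of_subset_Iio inter_subset_right

theorem inter_Iio_inter_Iio_of_le (A : Set Ordinal.{u}) {a b : Ordinal.{u}} (h : a ≤ b) :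
    A ∩ Iio b ∩ Iio a = A ∩ Iio a := by
  rw [inter_assoc, inter_eq_right.2 (Iio_subset_Iio h)]

theorem otp_inter_Iio_eq {A : Set Ordinal.{u}} {f : Ordinal.{u} → Ordinal.{u}}
    {o : Ordinal.{u}} (hf : StrictMonoOn f A) (him : f '' A = Iio o) {a : Ordinal.{u}}
    (ha : a ∈ A) : otp (A ∩ Iio a) = f a := by
  refine otp_eq_of_strictMonoOn (hf.mono inter_subset_left) ?_
  ext y
  constructor
  · rintro ⟨x, ⟨hx, hxa⟩, rfl⟩
    exact hf hx ha hxa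
  · intro hy
    have hao : f a < o := him.subset ⟨a, ha, rfl⟩
    obtain ⟨x, hx, rfl⟩ := him.superset (show y ∈ Iio o from lt_trans hy hao)
    exact ⟨x, ⟨hx, (hf.lt_iff_lt hx ha).1 hy⟩, rfl⟩

theorem otp_inter_Iio_lt {A : Set Ordinal.{u}} (hA : BddAbove A) {a : Ordinal.{u}}
    (ha : a ∈ A) : otp (A ∩ Iio a) < otp A := by
  obtain ⟨f, hf, him⟩ := exists_strictMonoOn_otp hA
  rw [otp_inter_Iio_eq hf him ha]
  exact him.subset ⟨a, ha, rfl⟩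

theorem otp_inter_Iio_lt_otp_inter_Iio {A : Set Ordinal.{u}} {a b : Ordinal.{u}}
    (ha : a ∈ A) (hab : a < b) : otp (A ∩ Iio a) < otp (A ∩ Iio b) := by
  have := otp_inter_Iio_lt (bddAbove_inter_Iio A b) (a := a) ⟨ha, hab⟩
  rwa [inter_Iio_inter_Iio_of_le A hab.le] at this

theorem exists_otp_inter_Iio_eq {A : Set Ordinal.{u}} (hA : BddAbove A) {τ : Ordinal.{u}}
    (hτ : τ < otp A) : ∃ a ∈ A, otp (A ∩ Iio a) = τ := by
  obtain ⟨f, hf, him⟩ := exists_strictMonoOn_otp hA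
  obtain ⟨a, ha, rfl⟩ := him.superset hτ
  exact ⟨a, ha, otp_inter_Iio_eq hf him ha⟩

theorem otp_le_of_forall_lt {A : Set Ordinal.{u}} (hA : BddAbove A) {o : Ordinal.{u}}
    (h : ∀ a ∈ A, otp (A ∩ Iio a) < o) : otp A ≤ o := by
  by_contra! hlt
  obtain ⟨a, ha, hao⟩ := exists_otp_inter_Iio_eq hA hlt
  exact (h a ha).ne hao

theorem otp_le_of_strictMonoOn {A : Set Ordinal.{u}} (hA : BddAbove A)
    {f : Ordinal.{u} → Ordinal.{u}} {o : Ordinal.{u}} (hf : StrictMonoOn f A)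
    (hfo : MapsTo f A (Iio o)) : otp A ≤ o := by
  have key : ∀ a ∈ A, otp (A ∩ Iio a) ≤ f a := by
    intro a
    induction a using WellFoundedLT.induction with
    | ind a ih =>
      intro ha
      refine otp_le_of_forall_lt (bddAbove_inter_Iio A a) fun b hb => ?_
      rw [inter_Iio_inter_Iio_of_le A (le_of_lt hb.2)]
      exact (ih b hb.2 hb.1).trans_lt (hf hb.1 ha hb.2)
  exact otp_le_of_forall_lt hA fun a ha => (key a ha).trans_lt (hfo ha)

theorem otp_mono {A B : Set Ordinal.{u}} (hB : BddAbove B) (h : A ⊆ B) : otp A ≤ otp B := by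
  obtain ⟨f, hf, him⟩ := exists_strictMonoOn_otp hB
  exact otp_le_of_strictMonoOn (hB.mono h) (hf.mono h) fun a ha => him.subset ⟨a, h ha, rfl⟩

theorem otp_le_of_subset_Iio {A : Set Ordinal.{u}} {o : Ordinal.{u}} (h : A ⊆ Iio o) :
    otp A ≤ o :=
  otp_le_of_strictMonoOn (bddAbove_of_subset_Iio h) strictMonoOn_id h

/-- Computes the position of the last point of an inserted interval. -/
theorem otp_union_Ico {A : Set Ordinal.{u}} {γ : Ordinal.{u}} (hA : A ⊆ Iio γ)
    (ξ : Ordinal.{u}) : otp (A ∪ Ico γ (γ + ξ)) = otp A + ξ := by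
  classical
  obtain ⟨f, hf, him⟩ := exists_strictMonoOn_otp (bddAbove_of_subset_Iio hA)
  refine otp_eq_of_strictMonoOn (f := fun x => if x < γ then f x else otp A + (x - γ)) ?_ ?_
  · rintro x hx y hy hxy
    have hfx : ∀ z, z ∈ A ∪ Ico γ (γ + ξ) → z < γ → z ∈ A := fun z hz hzγ =>
      hz.resolve_right fun h => h.1.not_gt hzγ
    by_cases hyγ : y < γ
    · simp only [hyγ, hxy.trans hyγ, if_true]
      exact hf (hfx x hx (hxy.trans hyγ)) (hfx y hy hyγ) hxy
    · by_cases hxγ : x < γ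
      · simp only [hyγ, hxγ, if_true, if_false]
        exact lt_of_lt_of_le (him.subset ⟨x, hfx x hx hxγ, rfl⟩) le_self_add
      · simp only [hyγ, hxγ, if_false]
        rw [add_lt_add_iff_left]
        rw [not_lt] at hyγ hxγ
        rwa [← add_lt_add_iff_left γ, Ordinal.add_sub_cancel_of_le hxγ,
          Ordinal.add_sub_cancel_of_le hyγ]
  · ext y
    constructor
    · rintro ⟨x, hx | hx, rfl⟩
      · simp only [mem_Iio, if_pos (show x < γ from hA hx)]
        exact lt_of_lt_of_le (him.subset ⟨x, hx, rfl⟩) le_self_add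
      · simp only [mem_Iio, if_neg hx.1.not_gt]
        rw [add_lt_add_iff_left, ← add_lt_add_iff_left γ, Ordinal.add_sub_cancel_of_le hx.1]
        exact hx.2
    · intro hy
      by_cases h : y < otp A
      · obtain ⟨x, hx, rfl⟩ := him.superset h
        exact ⟨x, Or.inl hx, if_pos (hA hx)⟩
      · rw [not_lt] at h
        refine ⟨γ + (y - otp A), Or.inr ⟨le_self_add, ?_⟩, ?_⟩
        · rw [add_lt_add_iff_left, ← add_lt_add_iff_left (otp A),
            Ordinal.add_sub_cancel_of_le h]
          exact hy
        · simp only [if_neg (show ¬ γ + (y - otp A) < γ from le_self_add.not_gt),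
            Ordinal.add_sub_cancel]
          exact Ordinal.add_sub_cancel_of_le h

theorem otp_eq_one_iff {A : Set Ordinal.{u}} (hA : BddAbove A) :
    otp A = 1 ↔ ∃ a, A = {a} := by
  constructor
  · intro h
    obtain ⟨f, hf, him⟩ := exists_strictMonoOn_otp hA
    rw [h] at him
    obtain ⟨a, ha, ha0⟩ := him.superset (show (0 : Ordinal) ∈ Iio 1 by simp)
    refine ⟨a, Subset.antisymm (fun b hb => ?_) (by simpa using ha)⟩
    have hb0 : f b ∈ Iio 1 := him.subset ⟨b, hb, rfl⟩
    have : f b = 0 := by simpa using hb0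
    exact hf.injOn hb ha (this.trans ha0.symm)
  · rintro ⟨a, rfl⟩
    refine otp_eq_of_strictMonoOn (f := fun _ => 0) ?_ ?_
    · rintro x rfl y rfl h
      exact (lt_irrefl _ h).elim
    · ext y
      simp

theorem mem_suc_one_iff {A : Set Ordinal.{u}} {γ : Ordinal.{u}} :
    γ ∈ suc 1 A ↔ γ ∈ A ∧ ∃ a, A ∩ Iio γ = {a} := by
  rw [← otp_eq_one_iff (bddAbove_inter_Iio A γ)]
  refine and_congr_right fun _ => ⟨?_, fun h => ⟨0, by simp, by simpa using h⟩⟩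
  rintro ⟨j, hj, h⟩
  rw [Order.lt_one_iff] at hj
  simpa [hj] using h

/-! ### Unbounded sets and cofinality -/

theorem mem_positive_Jbd_iff {δ : Ordinal.{u}} {B : Set Ordinal.{u}} :
    B ∈ positive δ (Jbd δ) ↔ B ⊆ Iio δ ∧ ∀ ε < δ, ∃ b ∈ B, ε < b := by
  refine and_congr_right fun hB => ?_
  constructor
  · intro h ε hε
    have hle : δ ≤ sSup B := not_lt.1 fun hlt => h ⟨hB, hlt⟩
    by_contra! hno
    exact (hle.trans (csSup_le' hno)).not_gt hε
  · rintro h ⟨-, hlt⟩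
    obtain ⟨b, hb, hlt'⟩ := h _ hlt
    exact (le_csSup (bddAbove_of_subset_Iio hB) hb).not_gt hlt'

/-- Fewer than `cf(δ)` ordinals below `δ` have a common bound below `δ`. -/
theorem exists_lt_forall_le_of_mk_lt_cof {δ : Ordinal.{u}} {s : Set Ordinal.{u}}
    (hs : #s < Cardinal.lift.{u + 1} δ.cof) (f : Ordinal.{u} → Ordinal.{u})
    (hf : ∀ i ∈ s, f i < δ) : ∃ b < δ, ∀ i ∈ s, f i ≤ b := by
  refine ⟨sSup (f '' s), ?_, fun i hi => le_csSup ⟨δ, ?_⟩ ⟨i, hi, rfl⟩⟩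
  · refine sSup_lt_of_lt_cof ?_ ?_
    · rw [← lift_cof]
      exact mk_image_le.trans_lt hs
    · rintro _ ⟨i, hi, rfl⟩
      exact hf i hi
  · rintro _ ⟨i, hi, rfl⟩
    exact (hf i hi).le

theorem lift_cof_le_mk_of_unbounded {δ : Ordinal.{u}} {s : Set Ordinal.{u}} (hs : s ⊆ Iio δ)
    (h : ∀ ε < δ, ∃ b ∈ s, ε < b) : Cardinal.lift.{u + 1} δ.cof ≤ #s := by
  by_contra! hlt
  obtain ⟨b, hb, hle⟩ := exists_lt_forall_le_of_mk_lt_cof hlt id fun i hi => hs hi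
  obtain ⟨x, hx, hbx⟩ := h b hb
  exact (hle x hx).not_gt hbx

/-! ### Clubs in a regular cardinal, uniformisation and stabilisation -/

theorem isClubIn_iff {δ : Ordinal.{u}} {D : Set Ordinal.{u}} :
    IsClubIn δ D ↔ D ⊆ Iio δ ∧ (∀ s ⊆ D, s.Nonempty → ∀ a < δ, IsLUB s a → a ∈ D) ∧
      ∀ ε < δ, ∃ d ∈ D, ε ≤ d := by
  rw [IsClubIn, isClub_iff]
  refine and_congr_right fun hD => and_congr ⟨fun h s hs hne a ha hlub => ?_,
    fun h s hs hne _ a hlub => ?_⟩ ⟨fun h ε hε => ?_, fun h ε => ?_⟩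
  · refine h (d := Subtype.val ⁻¹' s) (preimage_mono hs) ?_ (.of_linearOrder _) (a := ⟨a, ha⟩) ?_
    · obtain ⟨x, hx⟩ := hne
      exact ⟨⟨x, hD (hs hx)⟩, hx⟩
    · exact ⟨fun x hx => hlub.1 hx, fun b hb => hlub.2 fun x hx =>
        hb (a := ⟨x, hD (hs hx)⟩) hx⟩
  · refine h (Subtype.val '' s) (by rintro _ ⟨x, hx, rfl⟩; exact hs hx) (hne.image _) a a.2 ?_
    refine ⟨?_, fun b hb => ?_⟩
    · rintro _ ⟨x, hx, rfl⟩
      exact hlub.1 hx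
    · by_cases hbδ : b ∈ Iio δ
      · exact hlub.2 (show (⟨b, hbδ⟩ : Iio δ) ∈ _ from fun x hx => hb ⟨x, hx, rfl⟩)
      · exact (le_of_lt a.2).trans (not_lt.1 hbδ : δ ≤ b)
  · obtain ⟨d, hd, hle⟩ := h ⟨ε, hε⟩
    exact ⟨d, hd, hle⟩
  · obtain ⟨d, hd, hle⟩ := h ε ε.2
    exact ⟨⟨d, hD hd⟩, hd, hle⟩

theorem cof_Iio_ord {κ : Cardinal.{u}} (hκ : κ.IsRegular) :
    Order.cof (Iio κ.ord) = Cardinal.lift.{u + 1} κ := by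
  rw [Ordinal.cof_Iio, ← lift_cof, hκ.cof_ord]

theorem cof_Iio_ord_ne_aleph0 {κ : Cardinal.{u}} (hκ : κ.IsRegular) (hω : ℵ₀ < κ) :
    Order.cof (Iio κ.ord) ≠ ℵ₀ := by
  rw [cof_Iio_ord hκ]
  exact (by simpa using hω : ℵ₀ < Cardinal.lift.{u + 1} κ).ne'

theorem IsClubIn.inter {κ : Cardinal.{u}} (hκ : κ.IsRegular) (hω : ℵ₀ < κ)
    {D D' : Set Ordinal.{u}} (h : IsClubIn κ.ord D) (h' : IsClubIn κ.ord D') :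
    IsClubIn κ.ord (D ∩ D') :=
  ⟨inter_subset_left.trans h.1, h.2.inter (cof_Iio_ord_ne_aleph0 hκ hω) h'.2⟩

theorem IsClubIn.biInter {κ : Cardinal.{u}} (hκ : κ.IsRegular) (hω : ℵ₀ < κ)
    {s : Set Ordinal.{u}} (hs : #s < Cardinal.lift.{u + 1} κ)
    {D : Ordinal.{u} → Set Ordinal.{u}} (h : ∀ i ∈ s, IsClubIn κ.ord (D i)) :
    IsClubIn κ.ord {x | x < κ.ord ∧ ∀ i ∈ s, x ∈ D i} := by
  refine ⟨fun x hx => hx.1, ?_⟩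
  have := IsClub.iInter (f := fun i : s => (Subtype.val ⁻¹' D i : Set (Iio κ.ord)))
    (cof_Iio_ord_ne_aleph0 hκ hω) (by simpa [cof_Iio_ord hκ] using hs) fun i => (h i i.2).2
  convert this using 1
  ext x
  simp only [mem_preimage, mem_ofPred_eq, mem_iInter, Subtype.forall]
  exact and_iff_right x.2

theorem mk_Iio_ord (c : Cardinal.{u}) : #(Iio c.ord) = Cardinal.lift.{u + 1} c := by
  rw [Cardinal.mk_Iio_ordinal, card_ord]

theorem mk_Iio_lt {c : Cardinal.{u}} {o : Ordinal.{u}} (h : o < c.ord) :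
    #(Iio o) < Cardinal.lift.{u + 1} c := by
  rw [Cardinal.mk_Iio_ordinal, Cardinal.lift_lt]
  exact lt_ord.1 h

theorem mk_Iic_lt {c : Cardinal.{u}} (hc : ℵ₀ ≤ c) {o : Ordinal.{u}} (h : o < c.ord) :
    #(Iic o) < Cardinal.lift.{u + 1} c := by
  rw [← Order.Iio_succ]
  exact mk_Iio_lt ((isSuccLimit_ord hc).succ_lt h)

/-- The ordinals closed under adding `θ` form a club. -/
theorem isClubIn_add_closed {κ θ : Cardinal.{u}} (hω : ℵ₀ < κ) (hθ : θ < κ) :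
    IsClubIn κ.ord {x | x < κ.ord ∧ ∀ y < x, y + θ.ord ≤ x} := by
  refine isClubIn_iff.2 ⟨fun x hx => hx.1, fun s hs _ a ha hlub => ⟨ha, fun y hy => ?_⟩,
    fun ε hε => ?_⟩
  · obtain ⟨x, hx, hyx⟩ := (lt_isLUB_iff hlub).1 hy
    exact ((hs hx).2 y hyx).trans (hlub.1 hx)
  · refine ⟨ε + θ.ord * ω, ⟨?_, fun y hy => ?_⟩, le_self_add⟩
    · have hω' : ω < κ.ord := by rwa [lt_ord, card_omega0]
      exact (isPrincipal_add_ord hω.le) hε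
        ((isPrincipal_mul_ord hω.le) (ord_lt_ord.2 hθ) hω')
    · have hstep : ∀ z < θ.ord * ω, z + θ.ord ≤ θ.ord * ω := by
        intro z hz
        obtain ⟨n, hn, hzn⟩ := (lt_mul_iff_of_isSuccLimit isSuccLimit_omega0).1 hz
        calc z + θ.ord ≤ θ.ord * n + θ.ord := by gcongr
          _ = θ.ord * (n + 1) := by rw [mul_add, mul_one]
          _ ≤ θ.ord * ω := by
            gcongr
            exact (isSuccLimit_omega0.add_one_lt hn).le
      rcases lt_or_ge y ε with h | h
      · have hθ0 : θ.ord ≤ θ.ord * ω := le_mul_of_one_le_right' one_lt_omega0.le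
        exact add_le_add h.le hθ0
      · rw [← Ordinal.add_sub_cancel_of_le h, add_assoc]
        gcongr
        refine hstep _ ?_
        rwa [← add_lt_add_iff_left ε, Ordinal.add_sub_cancel_of_le h]

/-- If each of the fewer than κ parameters fails at some club, then by monotonicity all of them fail
at the intersection of these clubs. -/
theorem exists_forall_isClubIn {κ : Cardinal.{u}} (hκ : κ.IsRegular) (hω : ℵ₀ < κ)
    {s : Set Ordinal.{u}} (hs : #s < Cardinal.lift.{u + 1} κ)
    {Q : Set Ordinal.{u} → Ordinal.{u} → Prop}
    (hQ : ∀ D D' i, D ⊆ D' → Q D i → Q D' i)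
    (h : ∀ D, IsClubIn κ.ord D → ∃ i ∈ s, Q D i) :
    ∃ i ∈ s, ∀ D, IsClubIn κ.ord D → Q D i := by
  by_contra! hno
  choose! D hD hDQ using hno
  obtain ⟨i, hi, hQi⟩ := h _ (IsClubIn.biInter hκ hω hs hD)
  exact hDQ i hi (hQ _ _ i (fun x hx => hx.2 i hi) hQi)

/-- The decreasing sequence of sets obtained by iterating `F`, with intersections. -/
def iterInter (F : Set Ordinal.{u} → Set Ordinal.{u}) (X : Set Ordinal.{u})
    (i : Ordinal.{u}) : Set Ordinal.{u} :=
  {x | x ∈ X ∧ ∀ j, ∀ _ : j < i, x ∈ F (iterInter F X j)}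
termination_by i

/-- Otherwise every club can be shrunk so that each large `A D δ` loses an element. Iterating this
θ⁺ times and fixing a δ that is good for the final intersection, one subset of θ would lose θ⁺
distinct elements. -/
theorem exists_isClubIn_stable {κ θ : Cardinal.{u}} (hκ : κ.IsRegular) (hω : ℵ₀ < κ)
    (hθ : Order.succ θ < κ) {S : Set Ordinal.{u}}
    {A : Set Ordinal.{u} → Ordinal.{u} → Set Ordinal.{u}}
    (hAθ : ∀ D δ, A D δ ⊆ Iio θ.ord) (hA : ∀ D D' δ, D ⊆ D' → A D δ ⊆ A D' δ)
    (h : ∀ D, IsClubIn κ.ord D → ∃ δ ∈ S, Cardinal.lift.{u + 1} θ ≤ #(A D δ)) :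
    ∃ E, IsClubIn κ.ord E ∧ ∀ D, IsClubIn κ.ord D → D ⊆ E →
      ∃ δ ∈ S, Cardinal.lift.{u + 1} θ ≤ #(A D δ) ∧ A D δ = A E δ := by
  by_contra! hno
  choose! F hF hFsub hFne using hno
  have hE : ∀ i < (Order.succ θ).ord, IsClubIn κ.ord (iterInter F (Iio κ.ord) i) := by
    intro i
    induction i using WellFoundedLT.induction with
    | ind i ih =>
      intro hi
      rw [iterInter]
      exact IsClubIn.biInter hκ hω (mk_Iio_lt (hi.trans (ord_lt_ord.2 hθ)))
        fun j hj => hF _ (ih j hj (lt_trans hj hi))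
  set E := iterInter F (Iio κ.ord) with hEdef
  have hsub : ∀ i j, j < i → E i ⊆ F (E j) := by
    intro i j hj x hx
    rw [hEdef, iterInter] at hx
    exact hx.2 j hj
  obtain ⟨δ, hδ, hbig⟩ := h _ (IsClubIn.biInter hκ hω
    (s := Iio (Order.succ θ).ord) (mk_Iio_lt (ord_lt_ord.2 hθ)) fun i hi => hF _ (hE i hi))
  have hex : ∀ i < (Order.succ θ).ord, ∃ τ, τ ∈ A (E i) δ ∧ τ ∉ A (F (E i)) δ := by
    intro i hi
    have hne := hFne _ (hE i hi) δ hδ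
      (hbig.trans (mk_le_mk_of_subset (hA _ _ δ fun x hx => hx.2 i hi)))
    by_contra! hall
    exact hne (Subset.antisymm (hA _ _ δ (hFsub _ (hE i hi))) hall)
  choose! t ht htn using hex
  -- An element lost at stage j is absent from all later stages, so it cannot be lost again.
  have hinj : InjOn t (Iio (Order.succ θ).ord) := by
    have key : ∀ i < (Order.succ θ).ord, ∀ j < i, t i ≠ t j := fun i hi j hj heq =>
      htn j (hj.trans hi) (heq ▸ hA _ _ δ (hsub i j hj) (ht i hi))
    intro i hi j hj heq
    rcases lt_trichotomy i j with hij | hij | hij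
    · exact (key j hj i hij heq.symm).elim
    · exact hij
    · exact (key i hi j hij heq).elim
  have hle := mk_le_mk_of_subset (s := t '' Iio (Order.succ θ).ord) (t := Iio θ.ord)
    (by rintro _ ⟨i, hi, rfl⟩; exact hAθ _ _ (ht i hi))
  rw [mk_image_eq_of_injOn _ _ hinj, mk_Iio_ord, mk_Iio_ord, Cardinal.lift_le] at hle
  exact (Order.lt_succ θ).not_ge hle

/-! ### From `Ubd` to many colours attained cofinally -/

/-- A subset of `B` in which the value of `g` at each element is below all later elements. -/
def Sparse (B : Set Ordinal.{u}) (g : Ordinal.{u} → Ordinal.{u}) (β : Ordinal.{u}) : Prop :=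
  β ∈ B ∧ ∀ β', ∀ _ : β' < β, Sparse B g β' → g β' < β
termination_by β

theorem sparse_iff {B : Set Ordinal.{u}} {g : Ordinal.{u} → Ordinal.{u}} {β : Ordinal.{u}} :
    Sparse B g β ↔ β ∈ B ∧ ∀ β' < β, Sparse B g β' → g β' < β := by
  rw [Sparse]

/-- A bounded sparse set would have fewer than λ elements, so `g` would be bounded on it by
regularity, and any larger element of `B` would again be sparse. -/
theorem sparse_unbounded {lam : Cardinal.{u}} (hlam : lam.IsRegular) {B : Set Ordinal.{u}}
    (hBub : ∀ ε < lam.ord, ∃ b ∈ B, ε < b)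
    {g : Ordinal.{u} → Ordinal.{u}} (hg : ∀ η < lam.ord, g η < lam.ord) :
    ∀ ε < lam.ord, ∃ b, Sparse B g b ∧ ε < b := by
  intro ε hε
  by_contra! hno
  have hsub : {b | Sparse B g b} ⊆ Iic ε := hno
  obtain ⟨b, hb, hgb⟩ := exists_lt_forall_le_of_mk_lt_cof (δ := lam.ord)
    (s := {b | Sparse B g b})
    (by
      rw [hlam.cof_ord]
      exact (mk_le_mk_of_subset hsub).trans_lt (mk_Iic_lt hlam.aleph0_le hε)) g
    fun i hi => hg i ((hno i hi).trans_lt hε)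
  obtain ⟨β, hβ, hlt⟩ := hBub (max ε b) (max_lt hε hb)
  have : Sparse B g β := sparse_iff.2
    ⟨hβ, fun β' _ h => (hgb β' h).trans_lt ((le_max_right _ _).trans_lt hlt)⟩
  exact (hno β this).not_gt ((le_max_left _ _).trans_lt hlt)

/-- `Ubd` promises θ colours but each may be taken only once. Applying it to a sparse subset of `B`
removes this defect: beyond its first element above η, only colours taken cofinally in `B` remain.
-/
theorem exists_many_unbounded_colours {lam θ : Cardinal.{u}} (hlam : lam.IsRegular)
    (hθ : ℵ₀ ≤ θ) (hθlam : θ < lam) {c : Ordinal.{u} → Ordinal.{u} → Ordinal.{u}}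
    (hc : ∀ α β, α < β → β < lam.ord → c α β < θ.ord)
    (hub : ∀ B ∈ positive lam.ord (Jbd lam.ord),
      ∃ η < lam.ord, otp (c η '' {β ∈ B | η < β}) = θ.ord)
    {B : Set Ordinal.{u}} (hB : B ⊆ Iio lam.ord) (hBub : ∀ ε < lam.ord, ∃ b ∈ B, ε < b) :
    ∃ η < lam.ord, Cardinal.lift.{u + 1} θ ≤
      #{τ | τ < θ.ord ∧ ∀ ε < lam.ord, ∃ β ∈ B, ε < β ∧ c η β = τ} := by
  by_contra! hno
  set A : Ordinal.{u} → Set Ordinal.{u} := fun η =>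
    {τ | τ < θ.ord ∧ ∀ ε < lam.ord, ∃ β ∈ B, ε < β ∧ c η β = τ} with hA
  have h1 : ∀ η < lam.ord, ∃ e < lam.ord, ∀ β ∈ B, e < β → η < β → c η β ∈ A η := by
    intro η hη
    have : ∀ τ ∈ Iio θ.ord \ A η, ∃ ε < lam.ord, ∀ β ∈ B, ε < β → c η β ≠ τ := by
      intro τ hτ
      by_contra! hcon
      exact hτ.2 ⟨hτ.1, hcon⟩
    choose! f hf hfc using this
    obtain ⟨b, hb, hfb⟩ := exists_lt_forall_le_of_mk_lt_cof (δ := lam.ord)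
      (s := Iio θ.ord \ A η) (by
        rw [hlam.cof_ord]
        refine (mk_le_mk_of_subset sdiff_subset).trans_lt (mk_Iio_lt (ord_lt_ord.2 hθlam))) f hf
    refine ⟨b, hb, fun β hβ hbβ hηβ => ?_⟩
    by_contra hcA
    have hmem : c η β ∈ Iio θ.ord \ A η := ⟨hc η β hηβ (hB hβ), hcA⟩
    exact hfc _ hmem β hβ ((hfb _ hmem).trans_lt hbβ) rfl
  choose! e he hec using h1
  -- The η supplied by `Ubd` is known only after the sparse set is built, so `g` dominates all
  -- thresholds up to its argument.
  have h2 : ∀ η < lam.ord, ∃ g < lam.ord, ∀ η' ≤ η, e η' ≤ g := fun η hη =>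
    exists_lt_forall_le_of_mk_lt_cof (δ := lam.ord) (s := Iic η)
      (by rw [hlam.cof_ord]; exact mk_Iic_lt hlam.aleph0_le hη) e
      fun i hi => he i (lt_of_le_of_lt hi hη)
  choose! g hg hge using h2
  have hsparse : {b | Sparse B g b} ⊆ Iio lam.ord := fun b hb => hB (sparse_iff.1 hb).1
  obtain ⟨η, hη, hotp⟩ := hub {b | Sparse B g b} (mem_positive_Jbd_iff.2
    ⟨hsparse, sparse_unbounded hlam hBub hg⟩)
  set I := c η '' {β ∈ {b | Sparse B g b} | η < β} with hI
  have hIθ : I ⊆ Iio θ.ord := by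
    rintro _ ⟨β, hβ, rfl⟩
    exact hc η β hβ.2 (hsparse hβ.1)
  have hIcard : #I = Cardinal.lift.{u + 1} θ := by
    rw [mk_eq_lift_card_otp (bddAbove_of_subset_Iio hIθ), hotp, card_ord]
  obtain ⟨β, hβ, hβη⟩ := sparse_unbounded hlam hBub hg η hη
  have hne : {β ∈ {b | Sparse B g b} | η < β}.Nonempty := ⟨β, hβ, hβη⟩
  have hmin := csInf_mem hne
  set β₀ := sInf {β ∈ {b | Sparse B g b} | η < β} with hβ₀
  have hsub : I ⊆ insert (c η β₀) (A η) := by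
    rintro _ ⟨β, hβ, rfl⟩
    rcases (csInf_le' hβ : β₀ ≤ β).eq_or_lt with heq | hlt
    · exact Or.inl (congrArg (c η) heq.symm)
    · refine Or.inr (hec η hη β (sparse_iff.1 hβ.1).1 ?_ hβ.2)
      have hlam₀ : β₀ < lam.ord := hsparse hmin.1
      exact (hge β₀ hlam₀ η hmin.2.le).trans_lt ((sparse_iff.1 hβ.1).2 β₀ hlt hmin.1)
  have hlt : #(insert (c η β₀) (A η) : Set Ordinal.{u}) < Cardinal.lift.{u + 1} θ := by
    have hθ' : ℵ₀ ≤ Cardinal.lift.{u + 1} θ := by simpa using hθ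
    exact mk_insert_le.trans_lt (add_lt_of_lt hθ' (hno η hη) (one_lt_aleph0.trans_le hθ'))
  exact ((mk_le_mk_of_subset hsub).trans_lt hlt).ne hIcard

/-- A map into `θ` that attains every value on every interval of length `θ`. -/
theorem exists_map_surjOn_intervals {θ : Cardinal.{u}} (hθ : ℵ₀ ≤ θ) :
    ∃ h : Ordinal.{u} → Ordinal.{u}, (∀ x, h x < θ.ord) ∧
      ∀ σ, ∀ τ < θ.ord, ∃ ξ < θ.ord, h (σ + ξ) = τ := by
  classical
  have hθ' : ℵ₀ ≤ Cardinal.lift.{u + 1} θ := by simpa using hθ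
  have hpos : 0 < θ.ord := by
    rw [lt_ord, card_zero]
    exact aleph0_pos.trans_le hθ
  have hcard : #(Iio θ.ord × Iio θ.ord) = #(Iio θ.ord) := by
    rw [mk_prod, Cardinal.lift_id, mk_Iio_ord, mul_eq_self hθ']
  obtain ⟨e⟩ := Cardinal.eq.1 hcard
  refine ⟨fun x => (e.symm ⟨x % θ.ord, mod_lt _ hpos.ne'⟩).2, fun x => Subtype.prop _,
    fun σ τ hτ => ?_⟩
  -- Each colour τ has θ many codes below θ, so one of them lies at or above the residue of σ.
  have hex : ∃ i, σ % θ.ord ≤ (e (i, ⟨τ, hτ⟩) : Ordinal) := by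
    by_contra! hno
    have hle : #(Iio θ.ord) ≤ #(Iio (σ % θ.ord)) :=
      mk_le_of_injective (f := fun i => ⟨(e (i, ⟨τ, hτ⟩) : Ordinal), hno i⟩) fun i j hij => by
        have := congrArg Subtype.val hij
        simpa [Subtype.val_inj] using this
    rw [mk_Iio_ord] at hle
    exact hle.not_gt (mk_Iio_lt (mod_lt _ hpos.ne'))
  obtain ⟨i, hi⟩ := hex
  set b := e (i, ⟨τ, hτ⟩) with hb
  have hmod : (σ + ((b : Ordinal) - σ % θ.ord)) % θ.ord = b := by
    have hσ : σ + ((b : Ordinal) - σ % θ.ord) = θ.ord * (σ / θ.ord) + b := by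
      nth_rewrite 1 [← div_add_mod σ θ.ord]
      rw [add_assoc, Ordinal.add_sub_cancel_of_le hi]
    rw [hσ, mul_add_mod_self, mod_eq_of_lt b.2]
  refine ⟨(b : Ordinal) - σ % θ.ord, (Ordinal.sub_le_self _ _).trans_lt b.2, ?_⟩
  have hb' : (⟨_, mod_lt (σ + ((b : Ordinal) - σ % θ.ord)) hpos.ne'⟩ : Iio θ.ord) = b :=
    Subtype.ext hmod
  have he : (e.symm b).2 = ⟨τ, hτ⟩ := by rw [hb, Equiv.symm_apply_apply]
  beta_reduce
  rw [hb', he]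

/-! ### Inserting intervals into a set of ordinals -/

section Fill

variable {θ : Ordinal.{u}} {h : Ordinal.{u} → Ordinal.{u}}
  {K : Set Ordinal.{u} → Ordinal.{u}} {X : Set Ordinal.{u}}

/-- The length of the interval inserted after `γ ∈ X`, chosen so that the colour under `h` of the
position of its last point is `K (X ∩ γ)`. -/
def gap (θ : Ordinal.{u}) (h : Ordinal.{u} → Ordinal.{u}) (K : Set Ordinal.{u} → Ordinal.{u})
    (X : Set Ordinal.{u}) (γ : Ordinal.{u}) : Ordinal.{u} :=
  sInf {ξ | ξ < θ ∧ h (otp {x | x < γ ∧ ∃ γ', ∃ _ : γ' < γ, γ' ∈ X ∧ γ' ≤ x ∧ X ∩ Ioc γ' x = ∅ ∧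
    x ≤ γ' + gap θ h K X γ'} + ξ) = K (X ∩ Iio γ)}
termination_by γ

/-- The set `X` with an interval of length `gap` inserted after each of its points. -/
def fill (θ : Ordinal.{u}) (h : Ordinal.{u} → Ordinal.{u}) (K : Set Ordinal.{u} → Ordinal.{u})
    (X : Set Ordinal.{u}) : Set Ordinal.{u} :=
  {x | ∃ γ ∈ X, γ ≤ x ∧ X ∩ Ioc γ x = ∅ ∧ x ≤ γ + gap θ h K X γ}

theorem fill_inter_Iio_eq (γ : Ordinal.{u}) :
    {x | x < γ ∧ ∃ γ', ∃ _ : γ' < γ, γ' ∈ X ∧ γ' ≤ x ∧ X ∩ Ioc γ' x = ∅ ∧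
      x ≤ γ' + gap θ h K X γ'} = fill θ h K X ∩ Iio γ := by
  ext x
  constructor
  · rintro ⟨hx, γ', -, h1⟩
    exact ⟨⟨γ', h1⟩, hx⟩
  · rintro ⟨⟨γ', h1, h2, h3⟩, hx⟩
    exact ⟨hx, γ', h2.trans_lt hx, h1, h2, h3⟩

theorem gap_eq (γ : Ordinal.{u}) : gap θ h K X γ =
    sInf {ξ | ξ < θ ∧ h (otp (fill θ h K X ∩ Iio γ) + ξ) = K (X ∩ Iio γ)} := by
  rw [gap, fill_inter_Iio_eq]

theorem gap_lt (hθ : 0 < θ) (γ : Ordinal.{u}) : gap θ h K X γ < θ := by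
  rw [gap_eq]
  rcases eq_empty_or_nonempty
    {ξ | ξ < θ ∧ h (otp (fill θ h K X ∩ Iio γ) + ξ) = K (X ∩ Iio γ)} with h0 | h0
  -- When no length is suitable, the default infimum 0 is still below θ.
  · rwa [h0, Ordinal.sInf_empty]
  · exact (csInf_mem h0).1

theorem apply_otp_add_gap (hh : ∀ σ, ∀ τ < θ, ∃ ξ < θ, h (σ + ξ) = τ) {γ : Ordinal.{u}}
    (hK : K (X ∩ Iio γ) < θ) :
    h (otp (fill θ h K X ∩ Iio γ) + gap θ h K X γ) = K (X ∩ Iio γ) := by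
  rw [gap_eq]
  exact (csInf_mem (s := {ξ | ξ < θ ∧
    h (otp (fill θ h K X ∩ Iio γ) + ξ) = K (X ∩ Iio γ)}) (hh _ _ hK)).2

theorem subset_fill : X ⊆ fill θ h K X :=
  fun x hx => ⟨x, hx, le_rfl, by simp, le_self_add⟩

theorem inter_Iio_inter_Ioc_of_lt (X : Set Ordinal.{u}) {α γ x : Ordinal.{u}} (hx : x < α) :
    X ∩ Iio α ∩ Ioc γ x = X ∩ Ioc γ x := by
  have : Ioc γ x ⊆ Iio α := fun y hy => lt_of_le_of_lt hy.2 hx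
  rw [inter_assoc, inter_eq_right.2 this]

/-- The gap at γ depends only on X ∩ γ and on earlier gaps, so induction on γ applies. This locality
is what preserves both forms of coherence. -/
theorem gap_inter_Iio {α γ : Ordinal.{u}} (hγ : γ ≤ α) :
    gap θ h K (X ∩ Iio α) γ = gap θ h K X γ := by
  induction γ using WellFoundedLT.induction with
  | ind γ ih =>
    rw [gap_eq, gap_eq, inter_Iio_inter_Iio_of_le X hγ]
    have : fill θ h K (X ∩ Iio α) ∩ Iio γ = fill θ h K X ∩ Iio γ := by
      ext x
      refine and_congr_left fun hx => exists_congr fun γ' => ?_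
      have hxα : x < α := lt_of_lt_of_le hx hγ
      rw [inter_Iio_inter_Ioc_of_lt X hxα]
      constructor
      · rintro ⟨h1, h2, h3, h4⟩
        exact ⟨h1.1, h2, h3, by rwa [← ih γ' (h2.trans_lt hx) (h2.trans hxα.le)]⟩
      · rintro ⟨h1, h2, h3, h4⟩
        exact ⟨⟨h1, h2.trans_lt hxα⟩, h2, h3,
          by rwa [ih γ' (h2.trans_lt hx) (h2.trans hxα.le)]⟩
    rw [this]

theorem fill_inter_Iio {α β : Ordinal.{u}} (hβ : β ≤ α) :
    fill θ h K (X ∩ Iio α) ∩ Iio β = fill θ h K X ∩ Iio β := by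
  ext x
  refine and_congr_left fun hx => exists_congr fun γ' => ?_
  have hxα : x < α := lt_of_lt_of_le hx hβ
  rw [inter_Iio_inter_Ioc_of_lt X hxα]
  constructor
  · rintro ⟨h1, h2, h3, h4⟩
    exact ⟨h1.1, h2, h3, by rwa [← gap_inter_Iio (h2.trans hxα.le)]⟩
  · rintro ⟨h1, h2, h3, h4⟩
    exact ⟨⟨h1, h2.trans_lt hxα⟩, h2, h3, by rwa [gap_inter_Iio (h2.trans hxα.le)]⟩

/-- If X is bounded below α, closedness provides a last point γ of X below α, and only the interval
inserted after γ can accumulate to α. -/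
theorem sSup_inter_eq_or_of_sSup_fill_inter_eq {δ α : Ordinal.{u}}
    (hX : ∀ α < δ, 0 < α → sSup (X ∩ Iio α) = α → α ∈ X) (hα : α < δ) (hα0 : 0 < α)
    (hsup : sSup (fill θ h K X ∩ Iio α) = α) :
    sSup (X ∩ Iio α) = α ∨ ∃ γ ∈ X, γ < α ∧ X ∩ Ioo γ α = ∅ ∧ α ≤ γ + gap θ h K X γ := by
  have hle : sSup (X ∩ Iio α) ≤ α := csSup_le' fun x hx => le_of_lt hx.2
  refine hle.eq_or_lt.imp_right fun hlt => ?_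
  set γ := sSup (X ∩ Iio α) with hγ
  have hub : ∀ x ∈ X, x < α → x ≤ γ := fun x hx hxα =>
    le_csSup (bddAbove_inter_Iio X α) ⟨hx, hxα⟩
  have hmem : γ ∈ X := by
    by_contra hγX
    -- The value 0 could be the default supremum of an empty set, but `fill` has a point below α,
    -- hence so does X.
    have hpos : 0 < γ := by
      by_contra hγ0
      have hne : (fill θ h K X ∩ Iio α).Nonempty := by
        by_contra hne
        rw [not_nonempty_iff_eq_empty] at hne
        rw [hne, csSup_empty, Ordinal.bot_eq_zero] at hsup
        exact hα0.ne hsup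
      obtain ⟨x, ⟨γ', hγ', hγx, -⟩, hxα⟩ := hne
      have h1 := hub γ' hγ' (hγx.trans_lt hxα)
      have h2 : γ = 0 := by simpa using hγ0
      rw [h2, nonpos_iff_eq_zero] at h1
      exact hγX (h2 ▸ h1 ▸ hγ')
    refine hγX (hX γ (hlt.trans hα) hpos ?_)
    have hset : X ∩ Iio γ = X ∩ Iio α := by
      refine Subset.antisymm (inter_subset_inter_right _ (Iio_subset_Iio hle)) fun x hx => ?_
      exact ⟨hx.1, lt_of_le_of_ne (hub x hx.1 hx.2) fun heq => hγX (heq ▸ hx.1)⟩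
    rw [hset]
  refine ⟨γ, hmem, hlt, ?_, ?_⟩
  · refine eq_empty_of_forall_notMem fun x hx => ?_
    exact (hub x hx.1 hx.2.2).not_gt hx.2.1
  · rw [← hsup]
    refine csSup_le' ?_
    rintro x ⟨⟨γ', hγ', hγx, hemp, hxg⟩, hxα⟩
    rcases lt_or_ge γ x with hx | hx
    · have : γ' = γ := by
        refine (hub γ' hγ' (hγx.trans_lt hxα)).eq_of_not_lt fun hγ'γ => ?_
        exact (hemp.subset (show γ ∈ X ∩ Ioc γ' x from ⟨hmem, hγ'γ, hx.le⟩)).elim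
      exact this ▸ hxg
    · exact hx.trans le_self_add

theorem isCSeq_fill {R : Set Ordinal.{u}} {C : Ordinal.{u} → Set Ordinal.{u}} (hC : IsCSeq R C) :
    IsCSeq R fun δ => fill θ h K (C δ) ∩ Iio δ := by
  intro δ hδ
  obtain ⟨hsub, hcl, hsup⟩ := hC δ hδ
  refine ⟨inter_subset_right, fun α hα hα0 hs => ?_, le_antisymm ?_ ?_⟩
  · rw [inter_Iio_inter_Iio_of_le _ hα.le] at hs
    refine ⟨?_, hα⟩
    by_cases hαC : α ∈ C δ
    · exact subset_fill hαC
    rcases sSup_inter_eq_or_of_sSup_fill_inter_eq hcl hα hα0 hs with h1 | ⟨γ, hγ, hγα, hemp, hg⟩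
    · exact (hαC (hcl α hα hα0 h1)).elim
    · refine ⟨γ, hγ, hγα.le, eq_empty_of_forall_notMem fun x hx => ?_, hg⟩
      rcases hx.2.2.eq_or_lt with heq | hlt
      · exact hαC (heq ▸ hx.1)
      · exact (hemp.subset (show x ∈ C δ ∩ Ioo γ α from ⟨hx.1, hx.2.1, hlt⟩)).elim
  · exact csSup_le_csSup' bddAbove_Iio inter_subset_right
  · rw [← hsup]
    exact csSup_le_csSup' (bddAbove_of_subset_Iio inter_subset_right)
      fun x hx => ⟨subset_fill hx, hsub hx⟩

/-- Accumulation points of the original set are handled by locality. One inside an inserted interval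
has cofinality at most the size of a gap, which is below θ ≤ χ. -/
theorem isCoherent_fill {κ χ θ : Cardinal.{u}} (hθ : 0 < θ) (hχ : θ ≤ χ)
    {C : Ordinal.{u} → Set Ordinal.{u}} (hC : IsCSeq (Iio κ.ord) C) (hcoh : IsCoherent κ χ C) :
    IsCoherent κ χ fun δ => fill θ.ord h K (C δ) ∩ Iio δ := by
  rintro δ hδ δ' ⟨⟨hmem, hs, hpos⟩, hδ'κ, hcof⟩
  have hlt : δ' < δ := hmem.2
  rw [inter_Iio_inter_Iio_of_le _ hlt.le] at hs ⊢
  have hcl := (hC δ hδ).2.1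
  rcases sSup_inter_eq_or_of_sSup_fill_inter_eq hcl hlt hpos hs with h1 | ⟨γ, hγ, hγδ, -, hg⟩
  · beta_reduce
    rw [hcoh δ hδ δ' ⟨⟨hcl δ' hlt hpos h1, h1, hpos⟩, hδ'κ, hcof⟩, fill_inter_Iio le_rfl]
  · exfalso
    have hle : δ' - γ ≤ gap θ.ord h K (C δ) γ := Ordinal.sub_le.2 hg
    have hne : δ' - γ ≠ 0 := by
      rw [Ne, Ordinal.sub_eq_zero_iff_le]
      exact hγδ.not_ge
    have hθ0 : 0 < θ.ord := by rwa [lt_ord, card_zero]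
    have : δ'.cof < θ := by
      rw [← Ordinal.add_sub_cancel_of_le hγδ.le, cof_add _ hne]
      exact (cof_le_card _).trans_lt (lt_ord.1 (hle.trans_lt (gap_lt hθ0 γ)))
    exact (this.trans_le hχ).not_ge hcof

/-- By locality the new trace on α is determined by the old trace and min(δ, α), leaving fewer than
κ possibilities. -/
theorem isWeaklyCoherent_fill {κ : Cardinal.{u}} (hκ : ℵ₀ ≤ κ)
    {C : Ordinal.{u} → Set Ordinal.{u}} (hw : IsWeaklyCoherent κ C) :
    IsWeaklyCoherent κ fun δ => fill θ h K (C δ) ∩ Iio δ := by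
  intro α hα
  have hκ' : ℵ₀ ≤ Cardinal.lift.{u + 1} κ := by simpa using hκ
  have hsub : (fun δ => fill θ h K (C δ) ∩ Iio δ ∩ Iio α) '' Iio κ.ord ⊆
      (fun p : Set Ordinal.{u} × Ordinal.{u} => fill θ h K p.1 ∩ Iio p.2) ''
        (((fun δ => C δ ∩ Iio α) '' Iio κ.ord) ×ˢ Iic α) := by
    rintro _ ⟨δ, hδ, rfl⟩
    refine ⟨(C δ ∩ Iio α, min δ α), ⟨⟨δ, hδ, rfl⟩, mem_Iic.2 (min_le_right δ α)⟩, ?_⟩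
    simp only [fill_inter_Iio (min_le_right δ α), inter_assoc, Iio_inter_Iio]
  refine (mk_le_mk_of_subset hsub).trans_lt (mk_image_le.trans_lt ?_)
  rw [mk_setProd]
  exact mul_lt_of_lt hκ' (hw α hα) (mk_Iic_lt hκ hα)

theorem mk_fill_inter_Iio_le (hθ : 0 < θ) (y : Ordinal.{u}) :
    #(fill θ h K X ∩ Iio y : Set Ordinal.{u}) ≤ #(X ∩ Iio y : Set Ordinal.{u}) * #(Iio θ) := by
  have hsub : fill θ h K X ∩ Iio y ⊆
      (fun p : Ordinal.{u} × Ordinal.{u} => p.1 + p.2) '' ((X ∩ Iio y) ×ˢ Iio θ) := by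
    rintro x ⟨⟨γ, hγ, hγx, -, hg⟩, hx⟩
    exact ⟨(γ, x - γ), ⟨⟨hγ, hγx.trans_lt hx⟩, (Ordinal.sub_le.2 hg).trans_lt (gap_lt hθ γ)⟩,
      Ordinal.add_sub_cancel_of_le hγx⟩
  refine (mk_le_mk_of_subset hsub).trans (mk_image_le.trans ?_)
  rw [mk_setProd]

theorem mk_lt_iff_otp_lt_ord {A : Set Ordinal.{u}} (hA : BddAbove A) {c : Cardinal.{u}} :
    #A < Cardinal.lift.{u + 1} c ↔ otp A < c.ord := by
  rw [mk_eq_lift_card_otp hA, Cardinal.lift_lt, lt_ord]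

theorem otp_inter_Iio_lt_ord {A : Set Ordinal.{u}} {δ : Ordinal.{u}} (hA : A ⊆ Iio δ)
    {o : Ordinal.{u}} (hbdd : otp A ≤ o) (hub : ∀ ε < δ, ∃ b ∈ A, ε < b)
    {y : Ordinal.{u}} (hy : y < δ) : otp (A ∩ Iio y) < o := by
  obtain ⟨b, hb, hyb⟩ := hub y hy
  exact ((otp_mono (bddAbove_inter_Iio A b)
    (inter_subset_inter_right A (Iio_subset_Iio hyb.le))).trans_lt
      (otp_inter_Iio_lt (bddAbove_of_subset_Iio hA) hb)).trans_le hbdd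

theorem otp_fill_inter_Iio_le {lam θ : Cardinal.{u}} (hθ : 0 < θ) (hlam : ℵ₀ ≤ lam)
    (hθlam : θ < lam) {δ : Ordinal.{u}} (hX : X ⊆ Iio δ) (hbdd : otp X ≤ lam.ord)
    (hub : ∀ ε < δ, ∃ b ∈ X, ε < b) : otp (fill θ.ord h K X ∩ Iio δ) ≤ lam.ord := by
  have hlam' : ℵ₀ ≤ Cardinal.lift.{u + 1} lam := by simpa using hlam
  refine otp_le_of_forall_lt (bddAbove_inter_Iio _ _) fun a ha => ?_
  rw [inter_Iio_inter_Iio_of_le _ (le_of_lt ha.2),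
    ← mk_lt_iff_otp_lt_ord (bddAbove_inter_Iio _ _)]
  have hθ0 : 0 < θ.ord := by rwa [lt_ord, card_zero]
  refine (mk_fill_inter_Iio_le hθ0 a).trans_lt (mul_lt_of_lt hlam' ?_ ?_)
  · rw [mk_lt_iff_otp_lt_ord (bddAbove_inter_Iio _ _)]
    exact otp_inter_Iio_lt_ord hX hbdd hub ha.2
  · exact mk_Iio_lt (ord_lt_ord.2 hθlam)

theorem fill_inter_Iio_add_gap {γ : Ordinal.{u}} (hγ : γ ∈ X)
    (hemp : X ∩ Ioc γ (γ + gap θ h K X γ) = ∅) :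
    fill θ h K X ∩ Iio (γ + gap θ h K X γ) =
      fill θ h K X ∩ Iio γ ∪ Ico γ (γ + gap θ h K X γ) := by
  ext x
  constructor
  · rintro ⟨hx, hlt⟩
    rcases lt_or_ge x γ with h1 | h1
    · exact Or.inl ⟨hx, h1⟩
    · exact Or.inr ⟨h1, hlt⟩
  · rintro (⟨hx, hlt⟩ | ⟨h1, h2⟩)
    · exact ⟨hx, mem_Iio.2 (lt_of_lt_of_le hlt le_self_add)⟩
    · exact ⟨⟨γ, hγ, h1, subset_empty_iff.1
        ((inter_subset_inter_right X (Ioc_subset_Ioc_right h2.le)).trans hemp.subset), h2.le⟩, h2⟩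

/-- The last point of the interval inserted after `γ` sits at a position of colour `K (X ∩ γ)`,
and it is followed by the successor of `γ` in `X`. -/
theorem fill_add_gap_spec {δ γ ν : Ordinal.{u}} (hθ : 0 < θ)
    (hh : ∀ σ, ∀ τ < θ, ∃ ξ < θ, h (σ + ξ) = τ) (hγ : γ ∈ X) (hν : ν ∈ X) 
    (hemp : X ∩ Ioo γ ν = ∅) (hνδ : ν < δ) (hνθ : γ + θ ≤ ν) (hK : K (X ∩ Iio γ) < θ) :
    γ + gap θ h K X γ < ν ∧
    h (otp (fill θ h K X ∩ Iio δ ∩ Iio (γ + gap θ h K X γ))) = K (X ∩ Iio γ) ∧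
    suc 1 ((fill θ h K X ∩ Iio δ) \ Iio (γ + gap θ h K X γ)) ⊆ {ν} := by
  set β := γ + gap θ h K X γ with hβ
  have hβν : β < ν := (add_lt_add_right (gap_lt hθ γ) γ).trans_le hνθ
  have hemp' : X ∩ Ioc γ β = ∅ := by
    refine subset_empty_iff.1 (Subset.trans (inter_subset_inter_right X ?_) hemp.subset)
    exact fun x hx => ⟨hx.1, hx.2.trans_lt hβν⟩
  refine ⟨hβν, ?_, ?_⟩
  · rw [inter_Iio_inter_Iio_of_le _ (hβν.trans hνδ).le, fill_inter_Iio_add_gap hγ hemp',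
      otp_union_Ico inter_subset_right, apply_otp_add_gap hh hK]
  · intro x hx
    obtain ⟨⟨⟨⟨γ', hγ', hγx, hempx, hg⟩, hxδ⟩, hxβ⟩, a, ha⟩ := mem_suc_one_iff.1 hx
    rw [mem_Iio, not_lt] at hxβ
    have hβmem : β ∈ fill θ h K X := ⟨γ, hγ, le_self_add, hemp', le_rfl⟩
    have hβx : β < x := by
      refine hxβ.lt_of_ne fun heq => ?_
      have : a ∈ (fill θ h K X ∩ Iio δ) \ Iio β ∩ Iio x := ha.superset rfl
      exact this.1.2 (heq ▸ this.2)
    have hβa : β = a := ha.subset ⟨⟨⟨hβmem, hβν.trans hνδ⟩, lt_irrefl β⟩, hβx⟩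
    rcases lt_trichotomy x ν with hlt | heq | hlt
    · exfalso
      have hγx' : γ < x := lt_of_le_of_lt le_self_add hβx
      -- A point strictly between β and ν would lie in the block of γ, whose last point is β.
      have : γ' = γ := by
        rcases lt_trichotomy γ' γ with h1 | h1 | h1
        · exact (hempx.subset (show γ ∈ X ∩ Ioc γ' x from ⟨hγ, h1, hγx'.le⟩)).elim
        · exact h1
        · exact (hemp.subset (show γ' ∈ X ∩ Ioo γ ν from ⟨hγ', h1, hγx.trans_lt hlt⟩)).elim
      rw [this] at hg
      exact hg.not_gt hβx
    · exact heq
    · exfalso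
      have hνa : ν = a := ha.subset ⟨⟨⟨subset_fill hν, hνδ⟩, hβν.not_gt⟩, hlt⟩
      exact hβν.ne (hβa.trans hνa.symm)

end Fill

/-! ### Colours along a club-guessing sequence and their collapse -/

/-- The successor of `β` in `X` exists and belongs to `E`. -/
def NextIn (X E : Set Ordinal.{u}) (β : Ordinal.{u}) : Prop :=
  ∃ γ ∈ X, β < γ ∧ X ∩ Ioo β γ = ∅ ∧ γ ∈ E

theorem NextIn.mono {X E E' : Set Ordinal.{u}} {β : Ordinal.{u}} (hE : E ⊆ E')
    (h : NextIn X E β) : NextIn X E' β := by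
  obtain ⟨γ, h1, h2, h3, h4⟩ := h
  exact ⟨γ, h1, h2, h3, hE h4⟩

theorem nextIn_inter_Iio {X E : Set Ordinal.{u}} {α β : Ordinal.{u}} :
    NextIn (X ∩ Iio α) E β ↔ ∃ γ ∈ X, γ < α ∧ β < γ ∧ X ∩ Ioo β γ = ∅ ∧ γ ∈ E := by
  have key : ∀ γ < α, X ∩ Iio α ∩ Ioo β γ = X ∩ Ioo β γ := fun γ hγ => by
    have : Ioo β γ ⊆ Iio α := fun y hy => hy.2.trans hγ
    rw [inter_assoc, inter_eq_right.2 this]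
  constructor
  · rintro ⟨γ, h1, h2, h3, h4⟩
    exact ⟨γ, h1.1, h1.2, h2, key γ h1.2 ▸ h3, h4⟩
  · rintro ⟨γ, h1, h1', h2, h3, h4⟩
    exact ⟨γ, ⟨h1, h1'⟩, h2, (key γ h1').symm ▸ h3, h4⟩

/-- The colours below `θ` that `f` gives to the positions in `X` of cofinally many `β ∈ X` whose
successor in `X` belongs to `E`. -/
def cofinalColours (θ : Ordinal.{u}) (f : Ordinal.{u} → Ordinal.{u}) (X E : Set Ordinal.{u})
    (δ : Ordinal.{u}) : Set Ordinal.{u} :=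
  {τ | τ < θ ∧ ∀ ε < δ, ∃ β ∈ X, ε < β ∧ f (otp (X ∩ Iio β)) = τ ∧ NextIn X E β}

theorem cofinalColours_mono {θ : Ordinal.{u}} {f : Ordinal.{u} → Ordinal.{u}}
    {X E E' : Set Ordinal.{u}} {δ : Ordinal.{u}} (hE : E ⊆ E') :
    cofinalColours θ f X E δ ⊆ cofinalColours θ f X E' δ := by
  rintro τ ⟨h1, h2⟩
  refine ⟨h1, fun ε hε => ?_⟩
  obtain ⟨β, hβ, h3, h4, h5⟩ := h2 ε hε
  exact ⟨β, hβ, h3, h4, h5.mono hE⟩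

/-- The order type of the set of colours below that of the position `otp Y` which are taken at
positions in `Y` from `ε` on, at elements whose successor in `Y` belongs to `E`. -/
def collapsedColour (f : Ordinal.{u} → Ordinal.{u}) (ε : Ordinal.{u}) (E Y : Set Ordinal.{u}) :
    Ordinal.{u} :=
  otp {τ | τ < f (otp Y) ∧
    ∃ β ∈ Y, ε ≤ otp (Y ∩ Iio β) ∧ f (otp (Y ∩ Iio β)) = τ ∧ NextIn Y E β}

theorem unbounded_of_sSup_eq {δ : Ordinal.{u}} (hδ : Order.IsSuccLimit δ)
    {X : Set Ordinal.{u}} (hsup : sSup X = sSup (Iio δ)) : ∀ ε < δ, ∃ b ∈ X, ε < b := by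
  intro ε hε
  by_contra! hno
  have h1 : Order.succ ε ≤ sSup (Iio δ) := le_csSup bddAbove_Iio (hδ.succ_lt hε)
  exact (Order.lt_succ ε).not_ge (h1.trans (hsup ▸ csSup_le' hno))

theorem exists_nextIn_of_suc_subset {δ : Ordinal.{u}} {X E : Set Ordinal.{u}}
    (hX : X ⊆ Iio δ) (hub : ∀ ε < δ, ∃ b ∈ X, ε < b) {β : Ordinal.{u}} (hβ : β < δ)
    (hsuc : suc 1 (X \ Iio β) ⊆ E) : ∃ β' ∈ X, β ≤ β' ∧ NextIn X E β' := by
  have hne : {x ∈ X | β ≤ x}.Nonempty := by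
    obtain ⟨b, hb, hlt⟩ := hub β hβ
    exact ⟨b, hb, hlt.le⟩
  obtain ⟨h1, h2⟩ := csInf_mem hne
  set β' := sInf {x ∈ X | β ≤ x} with hβ'
  have hne' : {x ∈ X | β' < x}.Nonempty := hub β' (hX h1)
  obtain ⟨h3, h4⟩ := csInf_mem hne'
  set γ := sInf {x ∈ X | β' < x} with hγ
  refine ⟨β', h1, h2, γ, h3, h4, ?_, hsuc ?_⟩
  · refine eq_empty_of_forall_notMem fun x hx => ?_
    exact (csInf_le' (show x ∈ {x ∈ X | β' < x} from ⟨hx.1, hx.2.1⟩) : γ ≤ x).not_gt hx.2.2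
  · refine mem_suc_one_iff.2 ⟨⟨h3, (h2.trans h4.le).not_gt⟩, β', ?_⟩
    ext x
    constructor
    · rintro ⟨⟨hx, hβx⟩, hxγ⟩
      have h5 : β' ≤ x := csInf_le' ⟨hx, not_lt.1 hβx⟩
      refine (h5.eq_or_lt.resolve_right fun hlt => ?_).symm
      exact (csInf_le' (show x ∈ {x ∈ X | β' < x} from ⟨hx, hlt⟩) : γ ≤ x).not_gt hxγ
    · rintro rfl
      exact ⟨⟨h1, h2.not_gt⟩, h4⟩

/-- Positions are distinct for distinct points, and an unbounded subset of δ has at least λ points,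
too many for positions bounded below λ. -/
theorem otp_inter_Iio_unbounded {lam : Cardinal.{u}} (hlam : ℵ₀ ≤ lam) {δ : Ordinal.{u}}
    (hcof : δ.cof = lam) {X Z : Set Ordinal.{u}} (hX : X ⊆ Iio δ) (hZX : Z ⊆ X)
    (hZ : ∀ ε < δ, ∃ b ∈ Z, ε < b) : ∀ i < lam.ord, ∃ β ∈ Z, i < otp (X ∩ Iio β) := by
  intro i hi
  by_contra! hno
  have hinj : InjOn (fun β => otp (X ∩ Iio β)) Z := by
    have hmono : StrictMonoOn (fun β => otp (X ∩ Iio β)) Z := fun a ha b _ hab =>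
      otp_inter_Iio_lt_otp_inter_Iio (hZX ha) hab
    exact hmono.injOn
  have hle := mk_le_mk_of_subset (s := (fun β => otp (X ∩ Iio β)) '' Z) (t := Iic i)
    (by rintro _ ⟨β, hβ, rfl⟩; exact hno β hβ)
  rw [mk_image_eq_of_injOn _ _ hinj] at hle
  have := lift_cof_le_mk_of_unbounded (hZX.trans hX) hZ
  rw [hcof] at this
  exact (this.trans hle).not_gt (mk_Iic_lt hlam hi)

theorem lt_of_otp_inter_Iio_succ_le {X : Set Ordinal.{u}} {b β : Ordinal.{u}} (hβ : β ∈ X)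
    (h : otp (X ∩ Iio (Order.succ b)) ≤ otp (X ∩ Iio β)) : b < β := by
  by_contra! hle
  exact (otp_inter_Iio_lt_otp_inter_Iio hβ (Order.lt_succ_of_le hle)).not_ge h

theorem exists_many_cofinalColours {lam θ : Cardinal.{u}} (hlam : lam.IsRegular)
    (hθ : ℵ₀ ≤ θ) (hθlam : θ < lam) {c : Ordinal.{u} → Ordinal.{u} → Ordinal.{u}}
    (hc : ∀ α β, α < β → β < lam.ord → c α β < θ.ord)
    (hub : ∀ B ∈ positive lam.ord (Jbd lam.ord),
      ∃ η < lam.ord, otp (c η '' {β ∈ B | η < β}) = θ.ord)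
    {δ : Ordinal.{u}} (hcof : δ.cof = lam) (hδ : Order.IsSuccLimit δ)
    {X E : Set Ordinal.{u}} (hX : X ⊆ Iio δ) (hbdd : otp X ≤ lam.ord)
    (hE : ∀ ε < δ, ∃ β ∈ X, ε < β ∧ NextIn X E β) :
    ∃ η < lam.ord, Cardinal.lift.{u + 1} θ ≤ #(cofinalColours θ.ord (c η) X E δ) := by
  have hXub : ∀ ε < δ, ∃ β ∈ X, ε < β := fun ε hε => by
    obtain ⟨β, hβ, hlt, -⟩ := hE ε hε
    exact ⟨β, hβ, hlt⟩
  have hZ : ∀ ε < δ, ∃ β ∈ {β ∈ X | NextIn X E β}, ε < β := fun ε hε => by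
    obtain ⟨β, hβ, hlt, hn⟩ := hE ε hε
    exact ⟨β, ⟨hβ, hn⟩, hlt⟩
  obtain ⟨η, hη, hbig⟩ := exists_many_unbounded_colours hlam hθ hθlam hc hub
    (B := (fun β => otp (X ∩ Iio β)) '' {β ∈ X | NextIn X E β})
    (by
      rintro _ ⟨β, hβ, rfl⟩
      exact (otp_inter_Iio_lt (bddAbove_of_subset_Iio hX) hβ.1).trans_le hbdd)
    (fun i hi => by
      obtain ⟨β, hβ, hlt⟩ := otp_inter_Iio_unbounded hlam.aleph0_le hcof hX
        (fun _ h => h.1) hZ i hi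
      exact ⟨_, ⟨β, hβ, rfl⟩, hlt⟩)
  refine ⟨η, hη, hbig.trans (mk_le_mk_of_subset ?_)⟩
  rintro τ ⟨hτ, h⟩
  refine ⟨hτ, fun ε hε => ?_⟩
  obtain ⟨_, ⟨β, ⟨hβ, hn⟩, rfl⟩, hlt, hcol⟩ :=
    h _ (otp_inter_Iio_lt_ord hX hbdd hXub (hδ.succ_lt hε))
  exact ⟨β, hβ, lt_of_otp_inter_Iio_succ_le hβ hlt.le, hcol, hn⟩

/-- From some position on, only colours of `cofinalColours` occur. -/
theorem exists_forall_mem_cofinalColours {lam θ : Cardinal.{u}} (hlam : ℵ₀ ≤ lam)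
    (hθlam : θ < lam) {f : Ordinal.{u} → Ordinal.{u}} {η : Ordinal.{u}} (hη : η < lam.ord)
    (hf : ∀ β, η < β → β < lam.ord → f β < θ.ord)
    {δ : Ordinal.{u}} (hcof : δ.cof = lam) (hδ : Order.IsSuccLimit δ)
    {X E : Set Ordinal.{u}} (hX : X ⊆ Iio δ) (hbdd : otp X ≤ lam.ord)
    (hXub : ∀ ε < δ, ∃ β ∈ X, ε < β) :
    ∃ ε < lam.ord, ∀ β ∈ X, ε ≤ otp (X ∩ Iio β) → NextIn X E β →
      f (otp (X ∩ Iio β)) ∈ cofinalColours θ.ord f X E δ := by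
  have hex : ∀ τ ∈ Iio θ.ord \ cofinalColours θ.ord f X E δ, ∃ ε < δ, ∀ β ∈ X, ε < β →
      f (otp (X ∩ Iio β)) = τ → ¬ NextIn X E β := by
    intro τ hτ
    by_contra! hno
    exact hτ.2 ⟨hτ.1, hno⟩
  choose! e he hec using hex
  obtain ⟨b, hb, hle⟩ := exists_lt_forall_le_of_mk_lt_cof (δ := δ)
    (s := Iio θ.ord \ cofinalColours θ.ord f X E δ) (by
      rw [hcof]
      exact (mk_le_mk_of_subset sdiff_subset).trans_lt (mk_Iio_lt (ord_lt_ord.2 hθlam))) e he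
  -- The first term forces β past the last occurrence of every non-cofinal colour; the second forces
  -- the position past η, where `f` takes values below θ.
  refine ⟨max (otp (X ∩ Iio (Order.succ b))) (Order.succ η),
    max_lt (otp_inter_Iio_lt_ord hX hbdd hXub (hδ.succ_lt hb))
      ((isSuccLimit_ord hlam).succ_lt hη), fun β hβ hε hn => ?_⟩
  have hbβ : b < β := lt_of_otp_inter_Iio_succ_le hβ ((le_max_left _ _).trans hε)
  have hfθ : f (otp (X ∩ Iio β)) < θ.ord :=
    hf _ (Order.succ_le_iff.1 ((le_max_right _ _).trans hε))
      ((otp_inter_Iio_lt (bddAbove_of_subset_Iio hX) hβ).trans_le hbdd)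
  by_contra hnot
  have hmem : f (otp (X ∩ Iio β)) ∈ Iio θ.ord \ cofinalColours θ.ord f X E δ := ⟨hfθ, hnot⟩
  exact hec _ hmem β hβ ((hle _ hmem).trans_lt hbβ) rfl hn

theorem otp_eq_ord_of_le_mk {θ : Cardinal.{u}} {A : Set Ordinal.{u}} (hA : A ⊆ Iio θ.ord)
    (h : Cardinal.lift.{u + 1} θ ≤ #A) : otp A = θ.ord := by
  refine le_antisymm (otp_le_of_subset_Iio hA) ?_
  rwa [ord_le, ← Cardinal.lift_le.{u + 1}, ← mk_eq_lift_card_otp (bddAbove_of_subset_Iio hA)]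

/-- If all colours taken from position `ε` on are cofinal colours with respect to `E`, and there
are `θ` many cofinal colours with respect to a smaller set `E'`, which are the same as those with
respect to `E`, then every collapsed colour is taken cofinally often. -/
theorem exists_collapsedColour_eq {lam θ : Cardinal.{u}} (hlam : ℵ₀ ≤ lam)
    (hθlam : θ < lam) {f : Ordinal.{u} → Ordinal.{u}} {δ : Ordinal.{u}} (hcof : δ.cof = lam)
    {X E E' : Set Ordinal.{u}} (hX : X ⊆ Iio δ) (hXub : ∀ ε < δ, ∃ β ∈ X, ε < β)
    (hbig : Cardinal.lift.{u + 1} θ ≤ #(cofinalColours θ.ord f X E' δ))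
    (heq : cofinalColours θ.ord f X E' δ = cofinalColours θ.ord f X E δ)
    {ε : Ordinal.{u}} (hε : ε < lam.ord)
    (htail : ∀ β ∈ X, ε ≤ otp (X ∩ Iio β) → NextIn X E β →
      f (otp (X ∩ Iio β)) ∈ cofinalColours θ.ord f X E δ)
    {τ : Ordinal.{u}} (hτ : τ < θ.ord) {ι : Ordinal.{u}} (hι : ι < δ) :
    ∃ β ∈ X, ι < β ∧ collapsedColour f ε E (X ∩ Iio β) = τ ∧ NextIn X E' β := by
  set A := cofinalColours θ.ord f X E δ with hA
  rw [heq] at hbig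
  have hAθ : A ⊆ Iio θ.ord := fun _ h => h.1
  have hotp := otp_eq_ord_of_le_mk hAθ hbig
  -- τ₀ is the τ-th element of A.
  obtain ⟨τ₀, hτ₀, hτ₀eq⟩ := exists_otp_inter_Iio_eq (bddAbove_of_subset_Iio hAθ)
    (hotp.symm ▸ hτ : τ < otp A)
  obtain ⟨β₁, hβ₁, hεβ₁⟩ := otp_inter_Iio_unbounded hlam hcof hX Subset.rfl hXub ε hε
  have hseen : ∀ τ' ∈ A, ∃ γ < δ, γ ∈ X ∧ γ ∈ E ∧ ∃ β ∈ X, ε ≤ otp (X ∩ Iio β) ∧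
      f (otp (X ∩ Iio β)) = τ' ∧ β < γ ∧ X ∩ Ioo β γ = ∅ := by
    intro τ' hτ'
    obtain ⟨β, hβ, hlt, hcol, γ, hγ, hβγ, hemp, hγE⟩ := hτ'.2 β₁ (hX hβ₁)
    exact ⟨γ, hX hγ, hγ, hγE, β, hβ,
      (hεβ₁.trans (otp_inter_Iio_lt_otp_inter_Iio hβ₁ hlt)).le, hcol, hβγ, hemp⟩
  choose! g hgδ hgX hgE hg using hseen
  -- As |A| ≤ θ < cf(δ), every colour of A has been seen past ε, together with the successor
  -- witnessing it, by a single stage b.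
  obtain ⟨b, hb, hgb⟩ := exists_lt_forall_le_of_mk_lt_cof (δ := δ) (s := A) (by
    rw [hcof]
    exact (mk_le_mk_of_subset hAθ).trans_lt (mk_Iio_lt (ord_lt_ord.2 hθlam))) g hgδ
  -- Stability is used here: τ₀ is cofinal for the smaller set E' as well.
  rw [← heq] at hτ₀
  obtain ⟨β, hβ, hlt, hcol, hn⟩ := hτ₀.2 (max b ι) (max_lt hb hι)
  refine ⟨β, hβ, (le_max_right _ _).trans_lt hlt, ?_, hn⟩
  rw [← hτ₀eq, collapsedColour, hcol]
  congr 1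
  ext τ'
  constructor
  · rintro ⟨h1, β', hβ', h2, h3, h4⟩
    rw [inter_Iio_inter_Iio_of_le X (le_of_lt hβ'.2)] at h2 h3
    obtain ⟨γ, h5, -, h6⟩ := nextIn_inter_Iio.1 h4
    exact ⟨h3 ▸ htail β' hβ'.1 h2 ⟨γ, h5, h6⟩, h1⟩
  · rintro ⟨h1, h2⟩
    obtain ⟨β', hβ', h3, h4, h5, h6⟩ := hg τ' h1
    have hgβ : g τ' < β := (hgb τ' h1).trans_lt ((le_max_left _ _).trans_lt hlt)
    have hβ'β : β' < β := h5.trans hgβ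
    refine ⟨h2, β', ⟨hβ', hβ'β⟩, ?_, ?_, ?_⟩
    · rwa [inter_Iio_inter_Iio_of_le X hβ'β.le]
    · rwa [inter_Iio_inter_Iio_of_le X hβ'β.le]
    · exact nextIn_inter_Iio.2 ⟨g τ', hgX τ' h1, hgβ, h5, h6, hgE τ' h1⟩

/-- A colouring of positions, a club `E` and a position `ε` that work uniformly for all clubs. -/
theorem exists_uniform_colouring {θ lam κ : Cardinal.{u}}
    (hκ : κ.IsRegular) (hθ : ℵ₀ ≤ θ) (hθlam : θ < lam) (hlam : lam.IsRegular) (hlamκ : lam < κ)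
    (hubd : Ubd lam (Jbd lam.ord) θ) {S T : Set Ordinal.{u}} (hScof : S ⊆ cofEq κ lam)
    {C : Ordinal.{u} → Set Ordinal.{u}} (hsub : ∀ δ ∈ S, C δ ⊆ Iio δ)
    (hub : ∀ δ ∈ S, ∀ ε < δ, ∃ β ∈ C δ, ε < β)
    (hbdd : IsBoundedSeq lam.ord S C)
    (hCG : ∀ D, IsClubIn κ.ord D → ∃ δ ∈ S,
      {β | β < δ ∧ suc 1 (C δ \ Iio β) ⊆ D ∩ T} ∈ positive δ (Jbd δ)) :
    ∃ f : Ordinal.{u} → Ordinal.{u}, ∃ E, ∃ ε < lam.ord,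
      ∀ D, IsClubIn κ.ord D → ∃ δ ∈ S,
        Cardinal.lift.{u + 1} θ ≤ #(cofinalColours θ.ord f (C δ) (D ∩ E ∩ T) δ) ∧
        cofinalColours θ.ord f (C δ) (D ∩ E ∩ T) δ = cofinalColours θ.ord f (C δ) (E ∩ T) δ ∧
        ∀ β ∈ C δ, ε ≤ otp (C δ ∩ Iio β) → NextIn (C δ) (E ∩ T) β →
          f (otp (C δ ∩ Iio β)) ∈ cofinalColours θ.ord f (C δ) (E ∩ T) δ := by
  obtain ⟨c, hc, hcub⟩ := hubd
  have hω : ℵ₀ < κ := hθ.trans_lt (hθlam.trans hlamκ)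
  have hlim : ∀ δ ∈ S, Order.IsSuccLimit δ := fun δ hδ =>
    one_lt_cof_iff.1 ((hScof hδ).2 ▸ one_lt_aleph0.trans_le hlam.aleph0_le)
  have hlamlt : #(Iio lam.ord) < Cardinal.lift.{u + 1} κ := mk_Iio_lt (ord_lt_ord.2 hlamκ)
  -- For a single club η comes from `Ubd`; since λ < κ, one η serves all clubs.
  obtain ⟨η, hη, hbig⟩ := exists_forall_isClubIn hκ hω hlamlt
    (Q := fun D η => ∃ δ ∈ S,
      Cardinal.lift.{u + 1} θ ≤ #(cofinalColours θ.ord (c η) (C δ) (D ∩ T) δ))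
    (by
      rintro D D' η hD ⟨δ, hδ, h⟩
      exact ⟨δ, hδ, h.trans (mk_le_mk_of_subset
        (cofinalColours_mono (inter_subset_inter_left T hD)))⟩)
    (by
      intro D hD
      obtain ⟨δ, hδ, hpos⟩ := hCG D hD
      have hpos := (mem_positive_Jbd_iff.1 hpos).2
      obtain ⟨η, hη, h⟩ := exists_many_cofinalColours hlam hθ hθlam
        (fun α β h1 h2 => (hc α β h1 h2).1) hcub (hScof hδ).2 (hlim δ hδ) (hsub δ hδ)
        (hbdd δ hδ) (E := D ∩ T) fun ε hε => by
          obtain ⟨β, ⟨hβ, hsuc⟩, hεβ⟩ := hpos ε hε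
          obtain ⟨β', hβ', hle, hn⟩ :=
            exists_nextIn_of_suc_subset (hsub δ hδ) (hub δ hδ) hβ hsuc
          exact ⟨β', hβ', hεβ.trans_le hle, hn⟩
      exact ⟨η, hη, δ, hδ, h⟩)
  obtain ⟨E, hE, hstab⟩ := exists_isClubIn_stable hκ hω (θ := θ)
    ((Order.succ_le_of_lt hθlam).trans_lt hlamκ) (S := S)
    (A := fun D δ => cofinalColours θ.ord (c η) (C δ) (D ∩ T) δ)
    (fun D δ τ h => h.1)
    (fun D D' δ hD => cofinalColours_mono (inter_subset_inter_left T hD)) hbig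
  -- The threshold depends on δ, hence on the club, but it ranges over λ < κ values.
  obtain ⟨ε, hε, hQ⟩ := exists_forall_isClubIn hκ hω hlamlt
    (Q := fun D ε => ∃ δ ∈ S,
        Cardinal.lift.{u + 1} θ ≤ #(cofinalColours θ.ord (c η) (C δ) (D ∩ E ∩ T) δ) ∧
        cofinalColours θ.ord (c η) (C δ) (D ∩ E ∩ T) δ =
          cofinalColours θ.ord (c η) (C δ) (E ∩ T) δ ∧
        ∀ β ∈ C δ, ε ≤ otp (C δ ∩ Iio β) → NextIn (C δ) (E ∩ T) β →
          c η (otp (C δ ∩ Iio β)) ∈ cofinalColours θ.ord (c η) (C δ) (E ∩ T) δ)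
    (by
      rintro D D' ε hD ⟨δ, hδ, h1, h2, h3⟩
      have h4 : cofinalColours θ.ord (c η) (C δ) (D ∩ E ∩ T) δ ⊆
          cofinalColours θ.ord (c η) (C δ) (D' ∩ E ∩ T) δ :=
        cofinalColours_mono (inter_subset_inter_left T (inter_subset_inter_left E hD))
      -- The colour sets for D ∩ E, D' ∩ E and E are nested and the outer two coincide.
      refine ⟨δ, hδ, h1.trans (mk_le_mk_of_subset h4), Subset.antisymm ?_ (h2 ▸ h4), h3⟩
      exact cofinalColours_mono (inter_subset_inter_left T inter_subset_right))
    (by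
      intro D hD
      obtain ⟨δ, hδ, h1, h2⟩ := hstab (D ∩ E) (hD.inter hκ hω hE) inter_subset_right
      obtain ⟨ε, hε, h3⟩ := exists_forall_mem_cofinalColours hlam.aleph0_le hθlam hη
        (fun β h1 h2 => (hc η β h1 h2).1) (hScof hδ).2 (hlim δ hδ) (E := E ∩ T)
        (hsub δ hδ) (hbdd δ hδ) (hub δ hδ)
      exact ⟨ε, hε, δ, hδ, h1, h2, h3⟩)
  exact ⟨c η, E, ε, hε, hQ⟩

end ClubGuessing

end

/-! ### The main theorem -/

theorem theorem4 (θ lam κ : Cardinal.{u})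
    (hκ : κ.IsRegular) (hθ : Cardinal.aleph0 ≤ θ) (hθlam : θ < lam) (hlamκ : lam < κ)
    (hubd : ClubGuessing.Ubd lam (ClubGuessing.Jbd lam.ord) θ)
    (S T : Set Ordinal.{u})
    (hS : ClubGuessing.IsStationaryIn κ.ord S) (hScof : S ⊆ ClubGuessing.cofEq κ lam)
    (hT : T ⊆ Set.Iio κ.ord)
    (C : Ordinal.{u} → Set Ordinal.{u})
    (hC : ClubGuessing.IsCSeq (Set.Iio κ.ord) C)
    (hCG : ClubGuessing.WitnessesCG κ lam.ord S T 1 ClubGuessing.Jbd C) :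
    ∃ C' : Ordinal.{u} → Set Ordinal.{u},
      ClubGuessing.IsCSeq (Set.Iio κ.ord) C' ∧
      ClubGuessing.IsBoundedSeq lam.ord S C' ∧
      (ClubGuessing.IsWeaklyCoherent κ C → ClubGuessing.IsWeaklyCoherent κ C') ∧
      (∀ χ : Cardinal.{u}, θ ≤ χ → χ < κ →
        ClubGuessing.IsCoherent κ χ C → ClubGuessing.IsCoherent κ χ C') ∧
      θ ∈ ClubGuessing.Theta1 κ S C' T 1 ClubGuessing.Jbd := by
  open ClubGuessing in
  obtain ⟨hCS, hbdd, hguess⟩ := hCG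
  have hω : ℵ₀ < κ := hθ.trans_lt (hθlam.trans hlamκ)
  have hlam₀ : ℵ₀ ≤ lam := hθ.trans hθlam.le
  have hθ0 : 0 < θ := aleph0_pos.trans_le hθ
  have hlim : ∀ δ ∈ S, Order.IsSuccLimit δ := fun δ hδ =>
    one_lt_cof_iff.1 ((hScof hδ).2 ▸ one_lt_aleph0.trans_le hlam₀)
  have hlam : lam.IsRegular := by
    obtain ⟨δ, hδ⟩ := hS.2.nonempty
    exact (hScof hδ).2 ▸ isRegular_cof (hlim δ hδ)
  have hsub : ∀ δ ∈ S, C δ ⊆ Iio δ := fun δ hδ => (hCS δ hδ).1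
  have hub : ∀ δ ∈ S, ∀ ε < δ, ∃ β ∈ C δ, ε < β := fun δ hδ =>
    unbounded_of_sSup_eq (hlim δ hδ) (hCS δ hδ).2.2
  obtain ⟨f, E, ε, hε, huni⟩ := exists_uniform_colouring hκ hθ hθlam hlam hlamκ hubd
    hScof hsub hub hbdd hguess
  obtain ⟨h, hhθ, hh⟩ := exists_map_surjOn_intervals hθ
  -- Cutting at δ matters when `C δ` has a maximum, since the last inserted interval could pass δ.
  refine ⟨fun δ => fill θ.ord h (collapsedColour f ε (E ∩ T)) (C δ) ∩ Iio δ, isCSeq_fill hC,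
    fun δ hδ => otp_fill_inter_Iio_le hθ0 hlam₀ hθlam (hsub δ hδ) (hbdd δ hδ) (hub δ hδ),
    isWeaklyCoherent_fill hω.le, fun χ hχ _ hcoh => isCoherent_fill hθ0 hχ hC hcoh,
    h, fun x _ => hhθ x, fun D hD => ?_⟩
  obtain ⟨δ, hδ, hbig, heq, htail⟩ :=
    huni _ (hD.inter hκ hω (isClubIn_add_closed hω (hθlam.trans hlamκ)))
  refine ⟨δ, hδ, fun τ hτ => mem_positive_Jbd_iff.2 ⟨fun β hβ => hβ.1, fun ι hι => ?_⟩⟩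
  obtain ⟨β, hβ, hεβ, hcol, ν, hν, hβν, hemp, hνE⟩ := exists_collapsedColour_eq hlam₀ hθlam
    (hScof hδ).2 (hsub δ hδ) (hub δ hδ) hbig heq hε htail hτ hι
  have hθord : 0 < θ.ord := by rwa [lt_ord, card_zero]
  -- The guessed successor ν is closed under adding θ, so β + θ ≤ ν leaves room for the inserted
  -- interval.
  obtain ⟨h1, h2, h3⟩ := fill_add_gap_spec (h := h) (K := collapsedColour f ε (E ∩ T)) hθord hh
    hβ hν hemp (hsub δ hδ hν) (hνE.1.1.2.2 β hβν) (hcol.symm ▸ hτ)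
  refine ⟨_, ⟨h1.trans (hsub δ hδ hν), h2.trans hcol, h3.trans ?_⟩, hεβ.trans_le le_self_add⟩
  rintro _ rfl
  exact ⟨hνE.1.1.1, hνE.2⟩
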